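/- Let $\varphi$ denote Euler's totient function and let $\gamma$ be the Euler–Mascheroni constant. For every odd positive integer $n$ other than $1, 3, 5, 9$ and $15$ we have $$\frac{n}{\varphi(n)} < e^{\gamma}\log\log n .$$ -/

import Mathlib

open Finset

/-! ### Numerical bounds for logarithms of real numbers -/

/-! Taking logarithms, the claim is that the sum of `-log (1 - 1/p)` over the primes dividing `n` is
below `γ + log log L`, where `L = log n`. Since those primes satisfy `∑ log p ≤ L`, any majorant `h
p + μ log p` of the summands, with `h` supported on small odd primes, bounds the sum by `∑ h + μ L`
(`log_div_totient_le`).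

For `L ≥ 100`, `h` covers the odd primes up to `L`. By Mertens their sum is about `log log L + γ -
log 2`; the absence of the prime 2 leaves enough slack for a crude explicit Mertens bound
(`sum_neg_log_one_sub_inv_le`), derived from `n!` and Chebyshev's bound on `θ`. For `5 ≤ L < 100` a
fixed `μ = 1/100` suffices. The remaining `n < 150` are checked through values of `φ`. -/

theorem log_two_three_five_smooth (a b c : ℤ) :
    Real.log (2 ^ a * 3 ^ b * 5 ^ c) = a * Real.log 2 + b * Real.log 3 + c * Real.log 5 := by
  rw [Real.log_mul (by positivity) (by positivity), Real.log_mul (by positivity) (by positivity),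
    Real.log_zpow, Real.log_zpow, Real.log_zpow]

/-- Numerical logarithms are all reduced to decimal bounds for `log 2`, `log 3`, `log 5` by
comparing `x` with a nearby 5-smooth rational. -/
theorem smooth_le_log {x : ℝ} (a b c : ℤ) (h : (2 : ℝ) ^ a * 3 ^ b * 5 ^ c ≤ x) :
    a * Real.log 2 + b * Real.log 3 + c * Real.log 5 ≤ Real.log x := by
  rw [← log_two_three_five_smooth]
  exact Real.log_le_log (by positivity) h

theorem log_le_smooth {x : ℝ} (hx : 0 < x) (a b c : ℤ) (h : x ≤ (2 : ℝ) ^ a * 3 ^ b * 5 ^ c) :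
    Real.log x ≤ a * Real.log 2 + b * Real.log 3 + c * Real.log 5 := by
  rw [← log_two_three_five_smooth]
  exact Real.log_le_log hx h

theorem eulerMascheroniConstant_gt : 0.569 < Real.eulerMascheroniConstant := by
  -- The index 63 makes the subtracted logarithm `log 64 = 6 log 2`.
  refine lt_trans ?_ (Real.eulerMascheroniSeq_lt_eulerMascheroniConstant 63)
  have h64 := log_two_three_five_smooth 6 0 0
  have h2 := Real.log_two_lt_d9
  norm_num at h64
  have : Real.eulerMascheroniSeq 63 = (harmonic 63 : ℝ) - Real.log 64 := by
    rw [Real.eulerMascheroniSeq]; norm_num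
  rw [this, h64]
  have hh : (4.728 : ℚ) < harmonic 63 := by
    simp only [harmonic, Finset.sum_range_succ, Finset.sum_range_zero]
    norm_num
  have hh' : ((4.728 : ℚ) : ℝ) < (harmonic 63 : ℝ) := by exact_mod_cast hh
  rw [show ((4.728 : ℚ) : ℝ) = 4.728 by norm_num] at hh'
  linarith

/-! ### The logarithm of `n / φ n` as a sum over primes -/

theorem log_div_totient {n : ℕ} (hn : n ≠ 0) :
    Real.log ((n : ℝ) / (n.totient : ℝ)) =
      ∑ p ∈ n.primeFactors, -Real.log (1 - (p : ℝ)⁻¹) := by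
  have h : (n.totient : ℝ) = n * ∏ p ∈ n.primeFactors, (1 - (p : ℝ)⁻¹) := by
    have := congrArg (fun q : ℚ => (q : ℝ)) (Nat.totient_eq_mul_prod_factors n)
    push_cast at this
    exact this
  have hpos : ∀ p ∈ n.primeFactors, (0 : ℝ) < 1 - (p : ℝ)⁻¹ := fun p hp => by
    have : (1 : ℝ) < p := by exact_mod_cast (Nat.prime_of_mem_primeFactors hp).one_lt
    exact sub_pos.2 (inv_lt_one_of_one_lt₀ this)
  have hn' : (n : ℝ) ≠ 0 := by exact_mod_cast hn
  rw [h, div_mul_cancel_left₀ hn', Real.log_inv, Real.log_prod (fun p hp => (hpos p hp).ne'),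
    Finset.sum_neg_distrib]

theorem neg_log_one_sub_inv_le {x : ℝ} (hx : 1 < x) : -Real.log (1 - x⁻¹) ≤ 1 / (x - 1) := by
  have h : 0 < 1 - x⁻¹ := sub_pos.2 (inv_lt_one_of_one_lt₀ hx)
  have := Real.one_sub_inv_le_log_of_pos h
  have e : (1 - x⁻¹)⁻¹ = 1 + 1 / (x - 1) := by
    have : x - 1 ≠ 0 := by linarith
    field_simp
    ring
  linarith

theorem inv_le_neg_log_one_sub_inv {x : ℝ} (hx : 1 < x) : x⁻¹ ≤ -Real.log (1 - x⁻¹) := by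
  have h : 0 < 1 - x⁻¹ := sub_pos.2 (inv_lt_one_of_one_lt₀ hx)
  have := Real.log_le_sub_one_of_pos h
  linarith

theorem sum_log_primeFactors_le (n : ℕ) (hn : n ≠ 0) :
    ∑ p ∈ n.primeFactors, Real.log p ≤ Real.log n := by
  rw [← Real.log_prod (fun p hp => by
    exact_mod_cast (Nat.prime_of_mem_primeFactors hp).ne_zero)]
  refine Real.log_le_log (Finset.prod_pos fun p hp => by
    exact_mod_cast (Nat.prime_of_mem_primeFactors hp).pos) ?_
  rw [← Nat.cast_prod]
  exact_mod_cast Nat.le_of_dvd (Nat.pos_of_ne_zero hn) (Nat.prod_primeFactors_dvd n)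

/-- If `-log (1 - 1 / p)` is at most `h p + μ log p` for the odd primes up to `m` and at most
`μ log p` for the larger ones, then `log (n / φ n)` is at most `μ log n` plus the sum of `h` over
the odd primes up to `m`. -/
theorem log_div_totient_le {n : ℕ} (hn : Odd n) (m : ℕ) {μ : ℝ} (hμ : 0 ≤ μ) (h : ℕ → ℝ)
    (h0 : ∀ p ∈ (Ioc 2 m).filter Nat.Prime, 0 ≤ h p)
    (h1 : ∀ p ∈ (Ioc 2 m).filter Nat.Prime, -Real.log (1 - (p : ℝ)⁻¹) ≤ h p + μ * Real.log p)
    (h2 : ∀ p : ℕ, p.Prime → m < p → -Real.log (1 - (p : ℝ)⁻¹) ≤ μ * Real.log p) :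
    Real.log ((n : ℝ) / (n.totient : ℝ)) ≤
      ∑ p ∈ (Ioc 2 m).filter Nat.Prime, h p + μ * Real.log n := by
  have hn0 : n ≠ 0 := fun h => by simp [h] at hn
  rw [log_div_totient hn0]
  have hodd : ∀ p ∈ n.primeFactors, 2 < p := fun p hp => by
    have hpp := Nat.prime_of_mem_primeFactors hp
    refine lt_of_le_of_ne hpp.two_le fun e => ?_
    have := Nat.dvd_of_mem_primeFactors hp
    rw [← e] at this
    exact (Nat.not_even_iff_odd.2 hn) (even_iff_two_dvd.2 this)
  calc ∑ p ∈ n.primeFactors, -Real.log (1 - (p : ℝ)⁻¹)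
      ≤ ∑ p ∈ n.primeFactors, ((if p ≤ m then h p else 0) + μ * Real.log p) := by
        refine Finset.sum_le_sum fun p hp => ?_
        have hpp := Nat.prime_of_mem_primeFactors hp
        split_ifs with hm
        · exact h1 p (by simp [hpp, hm, hodd p hp])
        · simpa using h2 p hpp (not_le.1 hm)
    _ = ∑ p ∈ n.primeFactors.filter (· ≤ m), h p + μ * ∑ p ∈ n.primeFactors, Real.log p := by
        rw [Finset.sum_add_distrib, Finset.sum_filter, Finset.mul_sum]
    _ ≤ _ := by
        refine add_le_add (Finset.sum_le_sum_of_subset_of_nonneg (fun p hp => ?_)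
          fun p hp _ => h0 p hp) (mul_le_mul_of_nonneg_left (sum_log_primeFactors_le n hn0) hμ)
        rw [Finset.mem_filter] at hp
        simp [Nat.prime_of_mem_primeFactors hp.1, hp.2, hodd p hp.1]

/-! ### An upper bound for the sum of `log p / p` -/

/-- Weak Stirling; the induction step amounts to `(n + 1) log ((n + 1) / n) ≥ 1`. -/
theorem log_factorial_le {n : ℕ} (hn : 1 ≤ n) :
    Real.log (n.factorial : ℝ) ≤ n * Real.log n - n + Real.log n + 1 := by
  induction n, hn using Nat.le_induction with
  | base => simp
  | succ n hn ih =>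
    have hn' : (0 : ℝ) < n := by exact_mod_cast hn
    have hf : (n.factorial : ℝ) ≠ 0 := by exact_mod_cast n.factorial_ne_zero
    have key := Real.one_sub_inv_le_log_of_pos (show (0 : ℝ) < (n + 1) / n by positivity)
    rw [Real.log_div (by positivity) hn'.ne'] at key
    have e : (1 : ℝ) - (((n : ℝ) + 1) / n)⁻¹ = 1 / (n + 1) := by field_simp; ring
    rw [e, div_le_iff₀ (by positivity)] at key
    rw [Nat.factorial_succ]
    push_cast
    rw [Real.log_mul (by positivity) hf]
    linarith

theorem div_le_factorization_factorial {n p : ℕ} (hp : p.Prime) :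
    n / p ≤ n.factorial.factorization p := by
  rw [← hp.pow_dvd_iff_le_factorization n.factorial_ne_zero]
  have h : p ^ (n / p) ∣ (p * (n / p)).factorial := by
    rw [hp.pow_dvd_iff_le_factorization (Nat.factorial_ne_zero _), Nat.factorization_factorial_mul hp]
    exact Nat.le_add_left _ _
  exact h.trans (Nat.factorial_dvd_factorial (Nat.mul_div_le n p))

/-- The exponent of `p` in `n!` is at least `⌊n/p⌋`. Replacing `⌊n/p⌋` by `n/p` costs at most `log
p` per prime, hence `θ(n) ≤ n log 4` in total. -/
theorem mul_sum_log_div_le (n : ℕ) :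
    n * ∑ p ∈ (Ioc 0 n).filter Nat.Prime, Real.log p / p ≤
      Real.log (n.factorial : ℝ) + Real.log 4 * n := by
  have hθ := Chebyshev.theta_le_log4_mul_x (x := n) (Nat.cast_nonneg n)
  rw [Chebyshev.theta, Nat.floor_natCast] at hθ
  refine le_trans ?_ (add_le_add_right hθ _)
  have hfac : ∑ p ∈ (Ioc 0 n).filter Nat.Prime, ((n / p : ℕ) : ℝ) * Real.log p ≤
      Real.log (n.factorial : ℝ) := by
    rw [Real.log_nat_eq_sum_factorization, Finsupp.sum]
    calc ∑ p ∈ (Ioc 0 n).filter Nat.Prime, ((n / p : ℕ) : ℝ) * Real.log p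
        ≤ ∑ p ∈ (Ioc 0 n).filter Nat.Prime, (n.factorial.factorization p : ℝ) * Real.log p := by
          refine Finset.sum_le_sum fun p hp => ?_
          have hp' := (Finset.mem_filter.1 hp).2
          refine mul_le_mul_of_nonneg_right ?_ (Real.log_natCast_nonneg p)
          exact_mod_cast div_le_factorization_factorial hp'
      _ ≤ _ := by
          refine Finset.sum_le_sum_of_subset_of_nonneg (fun p hp => ?_)
            fun p _ _ => mul_nonneg (Nat.cast_nonneg _) (Real.log_natCast_nonneg p)
          simp only [Finset.mem_filter, Finset.mem_Ioc] at hp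
          rw [Nat.support_factorization, Nat.mem_primeFactors]
          exact ⟨hp.2, (hp.2.dvd_factorial).2 hp.1.2, n.factorial_ne_zero⟩
  refine le_trans ?_ (add_le_add_left hfac _)
  rw [Finset.mul_sum, ← Finset.sum_add_distrib]
  refine Finset.sum_le_sum fun p hp => ?_
  have hp' := (Finset.mem_filter.1 hp).2
  have h1 : (n : ℝ) / p ≤ (n / p : ℕ) + 1 := by
    rw [div_le_iff₀ (by exact_mod_cast hp'.pos)]
    exact_mod_cast (Nat.lt_div_mul_add (a := n) hp'.pos).le.trans (by lia)
  calc (n : ℝ) * (Real.log p / p) = n / p * Real.log p := by ring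
    _ ≤ ((n / p : ℕ) + 1) * Real.log p :=
        mul_le_mul_of_nonneg_right h1 (Real.log_natCast_nonneg p)
    _ = _ := by ring

theorem sum_log_div_le {n : ℕ} (hn : 64 ≤ n) :
    ∑ p ∈ (Ioc 0 n).filter Nat.Prime, Real.log p / p ≤ Real.log n + 0.468 := by
  have h1 := mul_sum_log_div_le n
  have h2 := log_factorial_le (n := n) (by lia)
  have hn' : (64 : ℝ) ≤ n := by exact_mod_cast hn
  have h64 := log_two_three_five_smooth 6 0 0
  have hl2 := Real.log_two_lt_d9
  norm_num at h64
  -- Tangent line of `log` at 64, controlling the error `(log n + 1) / n`.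
  have h3 : Real.log n ≤ 6 * Real.log 2 + (n / 64 - 1) := by
    rw [← h64]
    have := Real.log_le_sub_one_of_pos (show (0 : ℝ) < n / 64 by positivity)
    rw [Real.log_div (by positivity) (by norm_num)] at this
    linarith
  have h4 := Real.log_four_eq
  rw [h4] at h1
  refine le_of_mul_le_mul_left ?_ (show (0 : ℝ) < n by linarith)
  nlinarith

/-! ### Partial summation for the reciprocals of the primes -/

/-- An upper bound `log n + C` for the sum of `log p / p` over the primes up to `n` gives an upper
bound for the sum of the reciprocals of the primes. -/
theorem sum_inv_prime_le {m : ℕ} (hm : 2 ≤ m) (C : ℝ)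
    (hC : ∀ n, m ≤ n → ∑ p ∈ (Ioc 0 n).filter Nat.Prime, Real.log p / p ≤ Real.log n + C)
    {n : ℕ} (hn : m ≤ n) :
    ∑ p ∈ (Ioc m n).filter Nat.Prime, (p : ℝ)⁻¹ ≤
      Real.log (Real.log n) - Real.log (Real.log m) +
        (Real.log m + C - ∑ p ∈ (Ioc 0 m).filter Nat.Prime, Real.log p / p) / Real.log m := by
  set A : ℕ → ℝ := fun n => ∑ p ∈ (Ioc 0 n).filter Nat.Prime, Real.log p / p with hA
  -- The nonnegative boundary term of the Abel summation at `n` is kept so that the induction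
  -- closes.
  suffices h : ∑ p ∈ (Ioc m n).filter Nat.Prime, (p : ℝ)⁻¹ ≤
      Real.log (Real.log n) - Real.log (Real.log m) + (Real.log m + C - A m) / Real.log m
        - (Real.log n + C - A n) / Real.log n by
    have hl : 0 ≤ Real.log n := Real.log_natCast_nonneg n
    have := div_nonneg (sub_nonneg.2 (hC n hn)) hl
    simp only [hA] at h ⊢
    linarith
  induction n, hn using Nat.le_induction with
  | base => simp
  | succ n hn ih =>
    have hn1 : (2 : ℝ) ≤ n := by exact_mod_cast hm.trans hn
    have hL : 0 < Real.log n := Real.log_pos (by linarith)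
    have hlt : Real.log n ≤ Real.log (n + 1 : ℝ) := Real.log_le_log (by linarith) (by linarith)
    have hL' : 0 < Real.log (n + 1 : ℝ) := hL.trans_le hlt
    have hD : 0 ≤ Real.log n + C - A n := sub_nonneg.2 (hC n hn)
    have hdiv : (Real.log n + C - A n) / Real.log (n + 1 : ℝ) ≤
        (Real.log n + C - A n) / Real.log n := div_le_div_of_nonneg_left hD hL hlt
    have hll : 1 - Real.log n / Real.log (n + 1 : ℝ) ≤
        Real.log (Real.log (n + 1 : ℝ)) - Real.log (Real.log n) := by
      have := Real.one_sub_inv_le_log_of_pos (div_pos hL' hL)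
      rwa [inv_div, Real.log_div hL'.ne' hL.ne'] at this
    have hS : ∑ p ∈ (Ioc m (n + 1)).filter Nat.Prime, (p : ℝ)⁻¹ =
        ∑ p ∈ (Ioc m n).filter Nat.Prime, (p : ℝ)⁻¹ +
          (A (n + 1) - A n) / Real.log (n + 1 : ℝ) := by
      simp only [hA, Finset.sum_filter, Finset.sum_Ioc_succ_top hn,
        Finset.sum_Ioc_succ_top (Nat.zero_le n)]
      split_ifs
      · push_cast
        field_simp
        ring
      · simp
    rw [hS]
    push_cast
    have e : (Real.log (n + 1 : ℝ) + C - A (n + 1)) / Real.log (n + 1 : ℝ) =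
        (1 - Real.log n / Real.log (n + 1 : ℝ)) +
        (Real.log n + C - A n) / Real.log (n + 1 : ℝ)
          - (A (n + 1) - A n) / Real.log (n + 1 : ℝ) := by
      field_simp
      ring
    rw [e]
    linarith

theorem sum_inv_mul_pred_le {m n : ℕ} (hn : m ≤ n) :
    ∑ k ∈ Ioc m n, (1 / ((k : ℝ) - 1) - (k : ℝ)⁻¹) = 1 / (m : ℝ) - 1 / n := by
  induction n, hn using Nat.le_induction with
  | base => simp
  | succ n hn ih =>
    rw [Finset.sum_Ioc_succ_top hn, ih]
    push_cast
    rw [add_sub_cancel_right]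
    ring

/-! ### The case of large `n` -/

theorem sum_log_div_sixty_four_ge :
    2.95 ≤ ∑ p ∈ (Ioc 0 64).filter Nat.Prime, Real.log p / p := by
  have hs : (Ioc 0 64).filter Nat.Prime =
      {2, 3, 5, 7, 11, 13, 17, 19, 23, 29, 31, 37, 41, 43, 47, 53, 59, 61} := by decide +kernel
  have l2 := Real.log_two_gt_d9
  have l3 := Real.log_three_gt_d9
  have l5 := Real.log_five_gt_d9
  have u2 := Real.log_two_lt_d9
  have u3 := Real.log_three_lt_d9
  have u5 := Real.log_five_lt_d9
  have l7 := smooth_le_log (x := 7) (-2) 3 0 (by norm_num)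
  have l11 := smooth_le_log (x := 11) 5 (-1) 0 (by norm_num)
  have l13 := smooth_le_log (x := 13) 6 0 (-1) (by norm_num)
  have l17 := smooth_le_log (x := 17) (-3) 3 1 (by norm_num)
  have l19 := smooth_le_log (x := 19) (-2) 1 2 (by norm_num)
  have l23 := smooth_le_log (x := 23) (-1) 2 1 (by norm_num)
  have l29 := smooth_le_log (x := 29) 4 2 (-1) (by norm_num)
  have l31 := smooth_le_log (x := 31) 1 1 1 (by norm_num)
  have l37 := smooth_le_log (x := 37) 2 2 0 (by norm_num)
  have l41 := smooth_le_log (x := 41) 3 0 1 (by norm_num)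
  have l43 := smooth_le_log (x := 43) 7 (-1) 0 (by norm_num)
  have l47 := smooth_le_log (x := 47) 0 2 1 (by norm_num)
  have l53 := smooth_le_log (x := 53) 1 0 2 (by norm_num)
  have l59 := smooth_le_log (x := 59) 5 2 (-1) (by norm_num)
  have l61 := smooth_le_log (x := 61) 2 1 1 (by norm_num)
  rw [hs]
  push_cast at *
  norm_num
  linarith

theorem sum_neg_log_one_sub_inv (s : Finset ℕ) (hs : ∀ p ∈ s, 1 < p) :
    ∑ p ∈ s, -Real.log (1 - (p : ℝ)⁻¹) = Real.log (∏ p ∈ s, (1 - (p : ℝ)⁻¹)⁻¹) := by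
  rw [Real.log_prod fun p hp => ?_]
  · simp [Real.log_inv]
  · have : (1 : ℝ) < p := by exact_mod_cast hs p hp
    exact (inv_pos.2 (sub_pos.2 (inv_lt_one_of_one_lt₀ this))).ne'

theorem sum_neg_log_one_sub_inv_sixty_four_le :
    ∑ p ∈ (Ioc 2 64).filter Nat.Prime, -Real.log (1 - (p : ℝ)⁻¹) ≤ 1.3389 := by
  have hs : (Ioc 2 64).filter Nat.Prime =
      {3, 5, 7, 11, 13, 17, 19, 23, 29, 31, 37, 41, 43, 47, 53, 59, 61} := by decide +kernel
  rw [sum_neg_log_one_sub_inv _ fun p hp => (Finset.mem_filter.1 hp).2.one_lt, hs]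
  have l2 := Real.log_two_gt_d9
  have u5 := Real.log_five_lt_d9
  refine (log_le_smooth ?_ (-12) 0 6 ?_).trans ?_
  · norm_num
  · norm_num
  · push_cast
    linarith

theorem log_log_sixty_four_ge : 1.422 ≤ Real.log (Real.log 64) := by
  have h64 := log_two_three_five_smooth 6 0 0
  norm_num at h64
  have l2 := Real.log_two_gt_d9
  have l3 := Real.log_three_gt_d9
  have u5 := Real.log_five_lt_d9
  refine le_trans ?_ (smooth_le_log 5 4 (-4) ?_)
  · push_cast
    linarith
  · rw [h64]
    norm_num
    linarith

/-- Budget: 1.3389 from primes up to 64, 1/64 from replacing `1/(p - 1)` by `1/p` beyond (a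
telescoping sum), and 0.4035 - 1.422 from partial summation. -/
theorem sum_neg_log_one_sub_inv_le {n : ℕ} (hn : 64 ≤ n) :
    ∑ p ∈ (Ioc 2 n).filter Nat.Prime, -Real.log (1 - (p : ℝ)⁻¹) ≤
      Real.log (Real.log n) + 0.34 := by
  have hsplit : ∑ p ∈ (Ioc 2 n).filter Nat.Prime, -Real.log (1 - (p : ℝ)⁻¹) =
      ∑ p ∈ (Ioc 2 64).filter Nat.Prime, -Real.log (1 - (p : ℝ)⁻¹) +
      ∑ p ∈ (Ioc 64 n).filter Nat.Prime, -Real.log (1 - (p : ℝ)⁻¹) := by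
    simp only [Finset.sum_filter]
    exact (Finset.sum_Ioc_consecutive _ (by norm_num) hn).symm
  have htail : ∑ p ∈ (Ioc 64 n).filter Nat.Prime, -Real.log (1 - (p : ℝ)⁻¹) ≤
      ∑ p ∈ (Ioc 64 n).filter Nat.Prime, (p : ℝ)⁻¹ + 1 / 64 := by
    have h1 : ∑ p ∈ (Ioc 64 n).filter Nat.Prime, (1 / ((p : ℝ) - 1) - (p : ℝ)⁻¹) ≤
        ∑ p ∈ Ioc 64 n, (1 / ((p : ℝ) - 1) - (p : ℝ)⁻¹) := by
      refine Finset.sum_le_sum_of_subset_of_nonneg (Finset.filter_subset _ _) fun p hp _ => ?_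
      have : (64 : ℝ) < p := by exact_mod_cast (Finset.mem_Ioc.1 hp).1
      rw [sub_nonneg, ← one_div]
      exact one_div_le_one_div_of_le (by linarith) (by linarith)
    rw [sum_inv_mul_pred_le hn, Finset.sum_sub_distrib] at h1
    have h2 : ∑ p ∈ (Ioc 64 n).filter Nat.Prime, -Real.log (1 - (p : ℝ)⁻¹) ≤
        ∑ p ∈ (Ioc 64 n).filter Nat.Prime, 1 / ((p : ℝ) - 1) :=
      Finset.sum_le_sum fun p hp => neg_log_one_sub_inv_le (by
        exact_mod_cast (Finset.mem_filter.1 hp).2.one_lt)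
    have h3 : (0 : ℝ) ≤ 1 / n := by positivity
    push_cast at h1
    linarith
  have hinv := sum_inv_prime_le (m := 64) (by norm_num) 0.468 (fun n hn => sum_log_div_le hn) hn
  have hA := sum_log_div_sixty_four_ge
  have hP := sum_neg_log_one_sub_inv_sixty_four_le
  have hll := log_log_sixty_four_ge
  have h64 := log_two_three_five_smooth 6 0 0
  norm_num at h64
  have l2 := Real.log_two_gt_d9
  have u2 := Real.log_two_lt_d9
  push_cast at hinv
  have hq : (Real.log 64 + 0.468 - ∑ p ∈ (Ioc 0 64).filter Nat.Prime, Real.log p / p) /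
      Real.log 64 ≤ 0.4035 := by
    rw [div_le_iff₀ (by rw [h64]; linarith), h64]
    linarith
  rw [hsplit]
  linarith

theorem log_div_totient_lt_of_hundred_le {n : ℕ} (hn : Odd n) (hL : 100 ≤ Real.log n) :
    Real.log ((n : ℝ) / (n.totient : ℝ)) <
      Real.eulerMascheroniConstant + Real.log (Real.log (Real.log n)) := by
  set L := Real.log n with hLdef
  have hm : 100 ≤ ⌊L⌋₊ := Nat.le_floor (by exact_mod_cast hL)
  have hmL : (⌊L⌋₊ : ℝ) ≤ L := Nat.floor_le (by linarith)
  have l2 := Real.log_two_gt_d9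
  have l5 := Real.log_five_gt_d9
  have hlog : 4.605 ≤ Real.log L := by
    refine le_trans ?_ (smooth_le_log 2 0 2 (by norm_num; exact hL))
    push_cast
    linarith
  have hden : 0 < (L - 1) * Real.log L := mul_pos (by linarith) (by linarith)
  -- This `μ` makes `1/(p - 1) ≤ μ log p` an equality at `p = L`. Then `μ L ≤ 0.2194`, and `0.34 +
  -- 0.2194 < 0.569 < γ`.
  have key := log_div_totient_le hn ⌊L⌋₊ (μ := 1 / ((L - 1) * Real.log L)) (by positivity)
    (fun p => -Real.log (1 - (p : ℝ)⁻¹))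
    (fun p hp => by
      have : (1 : ℝ) < p := by exact_mod_cast (Finset.mem_filter.1 hp).2.one_lt
      exact le_trans (by positivity) (inv_le_neg_log_one_sub_inv this))
    (fun p _ => le_add_of_nonneg_right
      (mul_nonneg (by positivity) (Real.log_natCast_nonneg p)))
    (fun p hp hmp => by
      have hLp : L < p := (Nat.floor_lt (by linarith)).1 hmp
      refine (neg_log_one_sub_inv_le (by linarith)).trans ?_
      have h1 : Real.log L ≤ Real.log p := Real.log_le_log (by linarith) hLp.le
      rw [div_mul_eq_mul_div, one_mul, div_le_div_iff₀ (by linarith) hden, one_mul, mul_comm]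
      exact mul_le_mul h1 (by linarith) (by linarith) (by linarith))
  rw [← hLdef] at key
  have hμ : 1 / ((L - 1) * Real.log L) * L ≤ 0.2194 := by
    rw [div_mul_eq_mul_div, one_mul, div_le_iff₀ hden]
    nlinarith
  have hsum := sum_neg_log_one_sub_inv_le (n := ⌊L⌋₊) (by lia)
  have hmono : Real.log (Real.log (⌊L⌋₊ : ℝ)) ≤ Real.log (Real.log L) := by
    have h100 : (100 : ℝ) ≤ ⌊L⌋₊ := by exact_mod_cast hm
    exact Real.log_le_log (Real.log_pos (by linarith)) (Real.log_le_log (by linarith) hmL)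
  have hγ := eulerMascheroniConstant_gt
  linarith

/-! ### The case of medium `n` -/

theorem log_div_totient_le_of_odd {n : ℕ} (hn : Odd n) :
    Real.log ((n : ℝ) / (n.totient : ℝ)) ≤ 0.946 + Real.log n / 100 := by
  have l2 := Real.log_two_gt_d9
  have l3 := Real.log_three_gt_d9
  have l5 := Real.log_five_gt_d9
  have u2 := Real.log_two_lt_d9
  have u3 := Real.log_three_lt_d9
  have u5 := Real.log_five_lt_d9
  -- The inequality `1/(p - 1) ≤ log p / 100` already holds at `p = 31`.
  have key := log_div_totient_le hn 30 (μ := 1 / 100) (by norm_num)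
    (fun p => -Real.log (1 - (p : ℝ)⁻¹) - 1 / 100 * Real.log p)
    (fun p hp => by
      have hp' := Finset.mem_filter.1 hp
      have hp1 : (1 : ℝ) < p := by exact_mod_cast hp'.2.one_lt
      have hp29 : (p : ℝ) ≤ 29 := by
        have := (Finset.mem_Ioc.1 hp'.1).2
        have : p ≠ 30 := fun h => by rw [h] at hp'; exact absurd hp'.2 (by norm_num)
        exact_mod_cast (by lia : p ≤ 29)
      have h1 := inv_le_neg_log_one_sub_inv hp1
      have h2 : Real.log p ≤ 3.402 := by
        refine (log_le_smooth (by linarith) 1 1 1 (by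
          norm_num
          exact_mod_cast (by linarith : (p : ℝ) ≤ 30))).trans ?_
        push_cast
        linarith
      have h3 : 1 / 29 ≤ (p : ℝ)⁻¹ := by
        rw [← one_div]
        exact one_div_le_one_div_of_le (by linarith) hp29
      rw [sub_nonneg]
      linarith)
    (fun p _ => by rw [sub_add_cancel])
    (fun p hp h30 => by
      have hp31 : (31 : ℝ) ≤ p := by exact_mod_cast h30
      refine (neg_log_one_sub_inv_le (by linarith)).trans ?_
      have h1 : 1 / ((p : ℝ) - 1) ≤ 1 / 30 :=
        one_div_le_one_div_of_le (by norm_num) (by linarith)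
      have h2 : 3.401 ≤ Real.log p := by
        refine le_trans ?_ (smooth_le_log 1 1 1 (by norm_num; linarith))
        push_cast
        linarith
      linarith)
  refine key.trans ?_
  have hs : (Ioc 2 30).filter Nat.Prime = {3, 5, 7, 11, 13, 17, 19, 23, 29} := by decide +kernel
  have hsum : ∑ p ∈ (Ioc 2 30).filter Nat.Prime,
      (-Real.log (1 - (p : ℝ)⁻¹) - 1 / 100 * Real.log p) ≤ 0.946 := by
    rw [Finset.sum_sub_distrib,
      sum_neg_log_one_sub_inv _ fun p hp => (Finset.mem_filter.1 hp).2.one_lt, ← Finset.mul_sum,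
      ← Real.log_prod (fun p hp => by exact_mod_cast (Finset.mem_filter.1 hp).2.ne_zero), hs]
    have h1 : Real.log (∏ p ∈ ({3, 5, 7, 11, 13, 17, 19, 23, 29} : Finset ℕ),
        (1 - (p : ℝ)⁻¹)⁻¹) ≤ 1.1632 := by
      refine (log_le_smooth ?_ 4 0 (-1) ?_).trans ?_
      · norm_num
      · norm_num
      · push_cast
        linarith
    have h2 : 21.8 ≤ Real.log (∏ p ∈ ({3, 5, 7, 11, 13, 17, 19, 23, 29} : Finset ℕ),
        (p : ℝ)) := by
      refine le_trans ?_ (smooth_le_log 9 1 9 ?_)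
      · push_cast
        linarith
      · norm_num
    linarith
  linarith

theorem log_div_totient_lt_of_five_le {n : ℕ} (hn : Odd n) (hL : 5 ≤ Real.log n) :
    Real.log ((n : ℝ) / (n.totient : ℝ)) <
      Real.eulerMascheroniConstant + Real.log (Real.log (Real.log n)) := by
  rcases le_or_gt 100 (Real.log n) with h100 | h100
  · exact log_div_totient_lt_of_hundred_le hn h100
  have key := log_div_totient_le_of_odd hn
  have hγ := eulerMascheroniConstant_gt
  set L := Real.log n
  have l2 := Real.log_two_gt_d9
  have l3 := Real.log_three_gt_d9
  have l5 := Real.log_five_gt_d9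
  have u2 := Real.log_two_lt_d9
  have u3 := Real.log_three_lt_d9
  have u5 := Real.log_five_lt_d9
  have loglog : ∀ a b c d e f : ℤ, (2 : ℝ) ^ a * 3 ^ b * 5 ^ c ≤ L →
      (2 : ℝ) ^ d * 3 ^ e * 5 ^ f ≤ a * Real.log 2 + b * Real.log 3 + c * Real.log 5 →
      d * Real.log 2 + e * Real.log 3 + f * Real.log 5 ≤ Real.log (Real.log L) :=
    fun a b c d e f h1 h2 => smooth_le_log d e f (h2.trans (smooth_le_log a b c h1))
  -- On each of `[60, 100)`, `[20, 60)`, `[8, 20)`, `[5, 8)`, `log log L` is bounded below at the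
  -- left end and `0.946 + L / 100` above at the right end.
  rcases le_or_gt 60 L with h60 | h60
  · have := loglog 2 1 1 2 0 0 (by norm_num; linarith) (by norm_num; linarith)
    push_cast at this
    linarith
  rcases le_or_gt 20 L with h20 | h20
  · have := loglog 2 0 1 3 2 (-2) (by norm_num; linarith) (by norm_num; linarith)
    push_cast at this
    linarith
  rcases le_or_gt 8 L with h8 | h8
  · have := loglog 3 0 0 1 0 0 (by norm_num; linarith) (by norm_num; linarith)
    push_cast at this
    linarith
  · have := loglog 0 0 1 3 0 (-1) (by norm_num; linarith) (by norm_num; linarith)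
    push_cast at this
    linarith

/-! ### The case of small `n` -/

theorem exp_eulerMascheroniConstant_gt : 1.761 < Real.exp Real.eulerMascheroniConstant := by
  refine lt_of_lt_of_le ?_ (Real.exp_le_exp.2 eulerMascheroniConstant_gt.le)
  refine lt_of_lt_of_le ?_ (Real.sum_le_exp_of_nonneg (by norm_num) 4)
  simp only [Finset.sum_range_succ, Nat.factorial]
  norm_num

theorem le_log_seven : 1.9458 ≤ Real.log 7 := by
  have l2 := Real.log_two_gt_d9
  have l3 := Real.log_three_gt_d9
  have l5 := Real.log_five_gt_d9
  -- `7 ^ 4 = 2401` lies just above the smooth number 2400.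
  have h := smooth_le_log (x := 7 ^ 4) 5 1 2 (by norm_num)
  rw [Real.log_pow] at h
  push_cast at h
  linarith

/-- `15/8 = 3/2 · 5/4` is the largest `n/φ(n)` for odd `n` with at most two prime factors; 105 is
the only odd number below 150 with three. -/
theorem totient_ge_of_odd_of_lt :
    ∀ n ∈ Finset.Ico 21 150, Odd n → n ≠ 105 → 8 * n ≤ 15 * n.totient := by
  decide +kernel

/-- Only the primes 7, 11, 13, 17, 19 survive the exclusions; 7 needs a sharper estimate of `log
log`. -/
theorem totient_ge_of_odd_of_lt_twenty_one :
    ∀ n ∈ Finset.range 21, Odd n → n ∉ ({1, 3, 5, 9, 15} : Finset ℕ) →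
      n = 7 ∨ 11 ≤ n ∧ 10 * n ≤ 11 * n.totient := by
  decide +kernel

theorem div_totient_lt_of_log_log_ge {n : ℕ} {a b : ℕ} {c : ℝ} (ha : 0 < a) (hn : 0 < n)
    (hab : a * n ≤ b * n.totient) (hc : c ≤ Real.log (Real.log n)) (h : (b : ℝ) / a ≤ 1.761 * c)
    (hc0 : 0 < c) :
    (n : ℝ) / (n.totient : ℝ)
      < Real.exp Real.eulerMascheroniConstant * Real.log (Real.log (n : ℝ)) := by
  have h1 : (n : ℝ) / (n.totient : ℝ) ≤ b / a := by
    rw [div_le_div_iff₀ (by exact_mod_cast Nat.totient_pos.2 hn) (by exact_mod_cast ha), mul_comm]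
    exact_mod_cast hab
  calc (n : ℝ) / (n.totient : ℝ) ≤ b / a := h1
    _ ≤ 1.761 * c := h
    _ < Real.exp Real.eulerMascheroniConstant * c :=
        mul_lt_mul_of_pos_right exp_eulerMascheroniConstant_gt hc0
    _ ≤ _ := mul_le_mul_of_nonneg_left hc (Real.exp_pos _).le

theorem div_totient_lt_of_lt {n : ℕ} (hodd : Odd n) (hn : n < 150)
    (h1 : n ≠ 1) (h3 : n ≠ 3) (h5 : n ≠ 5) (h9 : n ≠ 9) (h15 : n ≠ 15) :
    (n : ℝ) / (n.totient : ℝ)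
      < Real.exp Real.eulerMascheroniConstant * Real.log (Real.log (n : ℝ)) := by
  have l2 := Real.log_two_gt_d9
  have l3 := Real.log_three_gt_d9
  have l5 := Real.log_five_gt_d9
  have u2 := Real.log_two_lt_d9
  have u3 := Real.log_three_lt_d9
  have u5 := Real.log_five_lt_d9
  have l7 := le_log_seven
  have hpos : 0 < n := hodd.pos
  have loglog : ∀ d e f : ℤ, ∀ x : ℝ, 0 < x → x ≤ n → (2 : ℝ) ^ d * 3 ^ e * 5 ^ f ≤ Real.log x →
      d * Real.log 2 + e * Real.log 3 + f * Real.log 5 ≤ Real.log (Real.log n) :=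
    fun d e f x hx hxn h => smooth_le_log d e f (h.trans (Real.log_le_log hx hxn))
  rcases lt_or_ge n 21 with h21 | h21
  · rcases totient_ge_of_odd_of_lt_twenty_one n (by simp [h21]) hodd
      (by simp [h1, h3, h5, h9, h15]) with rfl | ⟨h11, hφ⟩
    · refine div_totient_lt_of_log_log_ge (a := 6) (b := 7) (by norm_num) hpos (by decide)
        (loglog 0 5 (-3) 7 (by norm_num) (by norm_num) ?_) ?_ ?_
      · norm_num
        linarith
      · push_cast
        linarith
      · push_cast
        linarith
    · have h11' : (10 : ℝ) ≤ n := by exact_mod_cast (by lia : 10 ≤ n)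
      have h10 := Real.log_ten_eq
      refine div_totient_lt_of_log_log_ge (by norm_num) hpos hφ
        (loglog (-2) 2 0 10 (by norm_num) h11' ?_) ?_ ?_
      · norm_num
        linarith
      · push_cast
        linarith
      · push_cast
        linarith
  · have h20 : (21 : ℝ) ≤ n := by exact_mod_cast h21
    by_cases h105 : n = 105
    · subst h105
      refine div_totient_lt_of_log_log_ge (a := 16) (b := 35) (by norm_num) hpos (by decide +kernel)
        (loglog 2 0 0 100 (by norm_num) (by norm_num) ?_) ?_ ?_
      · refine le_trans ?_ (smooth_le_log 2 0 2 (by norm_num))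
        norm_num
        linarith
      · push_cast
        linarith
      · push_cast
        linarith
    · have hlog21 : Real.log 21 = Real.log 3 + Real.log 7 := by
        rw [← Real.log_mul (by norm_num) (by norm_num)]
        norm_num
      refine div_totient_lt_of_log_log_ge (by norm_num) hpos
        (totient_ge_of_odd_of_lt n (by simp [h21, hn]) hodd h105)
        (loglog 0 1 0 21 (by norm_num) h20 ?_) ?_ ?_
      · rw [hlog21]
        norm_num
        linarith
      · push_cast
        linarith
      · push_cast
        linarith

theorem theorem7 (n : ℕ) (hodd : Odd n)
    (h1 : n ≠ 1) (h3 : n ≠ 3) (h5 : n ≠ 5) (h9 : n ≠ 9) (h15 : n ≠ 15) :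
    (n : ℝ) / (Nat.totient n : ℝ)
      < Real.exp Real.eulerMascheroniConstant * Real.log (Real.log (n : ℝ)) := by
  rcases lt_or_ge n 150 with hn | hn
  · exact div_totient_lt_of_lt hodd hn h1 h3 h5 h9 h15
  have hn' : (150 : ℝ) ≤ n := by exact_mod_cast hn
  have hL : 5 ≤ Real.log n := by
    have l2 := Real.log_two_gt_d9
    have l3 := Real.log_three_gt_d9
    have l5 := Real.log_five_gt_d9
    refine le_trans ?_ (smooth_le_log 1 1 2 (by norm_num; exact hn))
    push_cast
    linarith
  have hLL : 0 < Real.log (Real.log n) := by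
    refine Real.log_pos ?_
    linarith
  have hφ : (0 : ℝ) < n.totient := by exact_mod_cast Nat.totient_pos.2 hodd.pos
  rw [← Real.log_lt_log_iff (div_pos (by linarith) hφ) (by positivity),
    Real.log_mul (Real.exp_pos _).ne' hLL.ne', Real.log_exp]
  exact log_div_totient_lt_of_five_le hodd hL
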